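/- For a finite simple graph $G$ on $n$ vertices, let $\lambda_1,\dots,\lambda_n$ be the eigenvalues of its adjacency matrix, counted with multiplicity, and for real $p>0$ let its $p$-Schatten energy be $$\mathcal{E}_p(G)=\sum_{i=1}^{n}|\lambda_i|^p .$$ Let $n\ge 1$, let $S_n$ be the star on $n$ vertices (one vertex joined to all the $n-1$ others, with no further edges) and let $P_n$ be the path on $n$ vertices. Then for every tree $T_n$ on $n$ vertices and every real $p$ with $0<p<2$, $$\mathcal{E}_p(S_n)\le \mathcal{E}_p(T_n)\le \mathcal{E}_p(P_n).$$ -/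

import Mathlib

namespace SchattenEnergy

open Classical in
/-- The real adjacency matrix of a graph is Hermitian (being real symmetric). -/
theorem adjMatrix_isHermitian {V : Type*} (G : SimpleGraph V) :
    (G.adjMatrix ℝ).IsHermitian := by
  ext i j
  simp [SimpleGraph.adjMatrix_apply, G.adj_comm]

open Classical in
/-- The `p`-Schatten energy of a finite graph: the sum of `|λ| ^ p` over the eigenvalues `λ` of its
real adjacency matrix, counted with multiplicity. -/
noncomputable def energy {V : Type*} [Fintype V] (p : ℝ) (G : SimpleGraph V) : ℝ :=
  ∑ i, |(adjMatrix_isHermitian G).eigenvalues i| ^ p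

end SchattenEnergy

namespace SchattenEnergy

/-! ### Determinants of `1 + a A` for the adjacency matrix `A` -/

/-! For 0 < p < 2 the substitution s = |x|t shows that the integral over t > 0 of log(1 + t²x²)
t^(-p-1) is a positive constant times |x|^p. Summing over eigenvalues turns the energy into a
weighted integral of log |det(1 + itA)|², so a pointwise comparison of these determinants suffices
(`energy_le_energy`). In a forest, removing a leaf v and then its neighbour u gives D(G) = D(G - v)
+ t² D(G - v - u), where D is the determinant. By induction D is real and at least 1. Each leaf adds
at least t², exactly t² in a star; the upper bound follows the recursion satisfied by paths. Deleted
vertices stay as isolated ones, contributing a factor 1, so the vertex type never changes. -/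

/-- If row `v` of a matrix vanishes off the diagonal, then the determinant does not depend on the
off-diagonal entries of column `v`. -/
theorem det_eq_of_row_diagonal {V R : Type*} [Fintype V] [DecidableEq V] [CommRing R]
    {M N : Matrix V V R} (v : V) (hM : ∀ j, j ≠ v → M v j = 0) (hN : ∀ j, j ≠ v → N v j = 0)
    (hv : M v v = N v v) (h : ∀ i j, i ≠ v → j ≠ v → M i j = N i j) : M.det = N.det := by
  rw [Matrix.det_apply, Matrix.det_apply]
  refine Finset.sum_congr rfl fun σ _ => ?_
  congr 1
  by_cases hσ : σ v = v
  · refine Finset.prod_congr rfl fun i _ => ?_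
    by_cases hi : i = v
    · rw [hi, hσ, hv]
    · exact h _ _ (fun h' => hi (σ.injective (h'.trans hσ.symm))) hi
  · have hi : σ.symm v ≠ v := fun h' => hσ (by rw [← h', Equiv.apply_symm_apply, h'])
    rw [Finset.prod_eq_zero (Finset.mem_univ (σ.symm v)),
      Finset.prod_eq_zero (Finset.mem_univ (σ.symm v))]
    · rw [Equiv.apply_symm_apply, hN _ hi]
    · rw [Equiv.apply_symm_apply, hM _ hi]

open Classical in
/-- The determinant of `1 + a A`, where `A` is the adjacency matrix of `G`. -/
noncomputable def shiftDet {V : Type*} [Fintype V] (a : ℂ) (G : SimpleGraph V) : ℂ :=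
  (1 + a • G.adjMatrix ℂ).det

theorem shiftDet_bot {V : Type*} [Fintype V] (a : ℂ) : shiftDet a (⊥ : SimpleGraph V) = 1 := by
  classical
  unfold shiftDet
  convert Matrix.det_one (n := V) (R := ℂ)
  ext i j
  simp [SimpleGraph.adjMatrix_apply]

/-- Expansion of `det (1 + a A)` at a leaf `v` with neighbour `u`. -/
theorem shiftDet_leaf {V : Type*} [Fintype V] (a : ℂ) {G : SimpleGraph V} {u v : V}
    (h : ∀ w, G.Adj v w ↔ w = u) :
    shiftDet a G = shiftDet a (G.deleteIncidenceSet v) -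
      a ^ 2 * shiftDet a ((G.deleteIncidenceSet v).deleteIncidenceSet u) := by
  classical
  have huv : u ≠ v := ((h u).2 rfl).ne'
  have hadj : ∀ w, G.Adj w v ↔ w = u := fun w => by rw [G.adj_comm, h]
  set B : Matrix V V ℂ := 1 + a • G.adjMatrix ℂ with hB
  set C : Matrix V V ℂ := 1 + a • (G.deleteIncidenceSet v).adjMatrix ℂ with hC
  have e1 : shiftDet a G = B.det := by
    unfold shiftDet
    congr!
  have e2 : shiftDet a (G.deleteIncidenceSet v) = C.det := by
    unfold shiftDet
    congr!
  have e3 : shiftDet a ((G.deleteIncidenceSet v).deleteIncidenceSet u) =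
      (C.updateRow u (Pi.single u 1)).det := by
    unfold shiftDet
    refine det_eq_of_row_diagonal u ?_ ?_ ?_ ?_
    · intro j hj
      simp [SimpleGraph.adjMatrix_apply, SimpleGraph.deleteIncidenceSet_adj, hj.symm]
    · intro j hj
      simp [hj]
    · simp [SimpleGraph.adjMatrix_apply]
    · intro i j hi hj
      simp [hC, SimpleGraph.adjMatrix_apply, SimpleGraph.deleteIncidenceSet_adj, Matrix.one_apply,
        hi, hj]
  -- Subtracting `a` times row `v` from row `u` clears entry (u, v) and changes entry (u, u) to 1 -
  -- a². Column `v` is then diagonal, so after transposing, row `v` no longer matters.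
  have e4 : B.det = (C.updateRow u (C u + (-a ^ 2) • Pi.single u 1)).det := by
    rw [← Matrix.det_updateRow_add_smul_self B huv (-a), ← Matrix.det_transpose,
      ← Matrix.det_transpose (C.updateRow _ _)]
    refine det_eq_of_row_diagonal v ?_ ?_ ?_ ?_
    · intro j hj
      by_cases hju : j = u
      · subst hju
        simp [hB, SimpleGraph.adjMatrix_apply, hadj, hj]
      · simp [hB, SimpleGraph.adjMatrix_apply, hadj, hj, hju]
    · intro j hj
      by_cases hju : j = u
      · subst hju
        simp [hC, SimpleGraph.adjMatrix_apply, SimpleGraph.deleteIncidenceSet_adj, hj]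
      · simp [hC, SimpleGraph.adjMatrix_apply, SimpleGraph.deleteIncidenceSet_adj, hj, hju]
    · simp [hB, hC, SimpleGraph.adjMatrix_apply, Matrix.updateRow_ne huv.symm]
    · intro i j hi hj
      by_cases hju : j = u
      · subst hju
        by_cases hij : i = j
        · subst hij
          simp [hB, hC, SimpleGraph.adjMatrix_apply, h, hi.symm]
          ring
        · simp [hB, hC, SimpleGraph.adjMatrix_apply, SimpleGraph.deleteIncidenceSet_adj, h, hi, hj,
            hij, Matrix.one_apply, hi.symm]
      · simp [hB, hC, SimpleGraph.adjMatrix_apply, SimpleGraph.deleteIncidenceSet_adj, hi, hj, hju,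
          Matrix.one_apply]
  rw [e1, e2, e3, e4, Matrix.det_updateRow_add, Matrix.det_updateRow_smul, Matrix.updateRow_eq_self]
  ring

open Classical in
/-- The determinant of `1 + a A` in terms of the eigenvalues of `A`. -/
theorem shiftDet_eq_prod {V : Type*} [Fintype V] (a : ℂ) (G : SimpleGraph V) :
    shiftDet a G = ∏ i, (1 + a * ((adjMatrix_isHermitian G).eigenvalues i : ℂ)) := by
  by_cases ha : a = 0
  · simp [ha, shiftDet]
  have hmap : G.adjMatrix ℂ = (G.adjMatrix ℝ).map (algebraMap ℝ ℂ) := by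
    ext i j
    simp [SimpleGraph.adjMatrix_apply, apply_ite]
  have hc : (G.adjMatrix ℂ).charpoly =
      ∏ i, (Polynomial.X - Polynomial.C ((adjMatrix_isHermitian G).eigenvalues i : ℂ)) := by
    rw [hmap, Matrix.charpoly_map, (adjMatrix_isHermitian G).charpoly_eq, Polynomial.map_prod]
    simp
  -- This makes the determinant a rescaled value of the characteristic polynomial at -1/a.
  have hM : 1 + a • G.adjMatrix ℂ = (-a) • (Matrix.scalar V (-a⁻¹) - G.adjMatrix ℂ) := by
    ext i j
    by_cases hij : i = j
    · subst hij; simp [ha]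
    · by_cases h : G.Adj i j <;> simp [hij, h]
  rw [shiftDet, hM, Matrix.det_smul, ← Matrix.eval_charpoly, hc, Polynomial.eval_prod,
    Fintype.card, ← Finset.prod_const, ← Finset.prod_mul_distrib]
  refine Finset.prod_congr rfl fun i _ => ?_
  simp
  field_simp
  ring

end SchattenEnergy

namespace SchattenEnergy

open MeasureTheory Set

/-! ### An integral representation of `|x| ^ p` for `0 < p < 2` -/

/-- The integrand is at most t^(1-p) near 0, which needs p < 2; at infinity the logarithm is beaten
by any power, which needs p > 0. -/
theorem integrableOn_log_one_add_sq_mul_rpow {p : ℝ} (hp0 : 0 < p) (hp2 : p < 2) :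
    IntegrableOn (fun t : ℝ => Real.log (1 + t ^ 2) * t ^ (-p - 1)) (Ioi 0) := by
  have hmeas : Measurable fun t : ℝ => Real.log (1 + t ^ 2) * t ^ (-p - 1) := by fun_prop
  have hlog : ∀ t : ℝ, 0 ≤ Real.log (1 + t ^ 2) := fun t =>
    Real.log_nonneg (by nlinarith [sq_nonneg t])
  rw [← Ioc_union_Ioi_eq_Ioi (zero_le_one' ℝ)]
  refine IntegrableOn.union ?_ ?_
  · have h1 : IntegrableOn (fun t : ℝ => t ^ (1 - p)) (Ioc 0 1) := by
      rw [← intervalIntegrable_iff_integrableOn_Ioc_of_le zero_le_one]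
      exact intervalIntegral.intervalIntegrable_rpow' (by linarith)
    refine Integrable.mono' h1 hmeas.aestronglyMeasurable ?_
    filter_upwards [ae_restrict_mem measurableSet_Ioc] with t ht
    have ht0 : 0 < t := ht.1
    have hpow : 0 ≤ t ^ (-p - 1) := Real.rpow_nonneg ht0.le _
    rw [Real.norm_of_nonneg (mul_nonneg (hlog t) hpow)]
    have h2 : Real.log (1 + t ^ 2) ≤ t ^ 2 := by
      have := Real.log_le_sub_one_of_pos (show 0 < 1 + t ^ 2 by positivity)
      linarith
    calc Real.log (1 + t ^ 2) * t ^ (-p - 1) ≤ t ^ 2 * t ^ (-p - 1) := by gcongr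
      _ = t ^ (1 - p) := by
        rw [← Real.rpow_natCast, ← Real.rpow_add ht0]
        congr 1
        push_cast
        ring
  -- Bounding the logarithm by a power with exponent p/4 costs t^(p/2), half of the available decay.
  · have h1 : IntegrableOn (fun t : ℝ => (2 ^ (p / 4) / (p / 4)) * t ^ (-p / 2 - 1)) (Ioi 1) :=
      (integrableOn_Ioi_rpow_of_lt (by linarith) one_pos).const_mul _
    refine Integrable.mono' h1 hmeas.aestronglyMeasurable ?_
    filter_upwards [ae_restrict_mem measurableSet_Ioi] with t ht
    have ht1 : 1 < t := ht
    have ht0 : 0 < t := by linarith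
    have hpow : 0 ≤ t ^ (-p - 1) := Real.rpow_nonneg ht0.le _
    rw [Real.norm_of_nonneg (mul_nonneg (hlog t) hpow)]
    have h2 : Real.log (1 + t ^ 2) ≤ 2 ^ (p / 4) / (p / 4) * t ^ (p / 2) := by
      calc Real.log (1 + t ^ 2) ≤ (1 + t ^ 2) ^ (p / 4) / (p / 4) :=
            Real.log_le_rpow_div (by positivity) (by positivity)
        _ ≤ (2 * t ^ 2) ^ (p / 4) / (p / 4) := by
            gcongr
            nlinarith
        _ = 2 ^ (p / 4) / (p / 4) * t ^ (p / 2) := by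
            rw [Real.mul_rpow (by norm_num) (by positivity), ← Real.rpow_natCast t 2,
              ← Real.rpow_mul ht0.le]
            push_cast
            rw [show (2 : ℝ) * (p / 4) = p / 2 by ring]
            ring
    calc Real.log (1 + t ^ 2) * t ^ (-p - 1)
        ≤ 2 ^ (p / 4) / (p / 4) * t ^ (p / 2) * t ^ (-p - 1) := by gcongr
      _ = 2 ^ (p / 4) / (p / 4) * t ^ (-p / 2 - 1) := by
        rw [mul_assoc, ← Real.rpow_add ht0]
        congr 2
        ring

/-- The normalising constant of the integral representation of `|x| ^ p`. -/
noncomputable def coulsonConst (p : ℝ) : ℝ :=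
  ∫ t in Ioi (0 : ℝ), Real.log (1 + t ^ 2) * t ^ (-p - 1)

theorem coulsonConst_pos {p : ℝ} (hp0 : 0 < p) (hp2 : p < 2) : 0 < coulsonConst p := by
  have hpos : ∀ t ∈ Ioi (0 : ℝ), 0 < Real.log (1 + t ^ 2) * t ^ (-p - 1) := fun t ht => by
    have ht0 : 0 < t := ht
    exact mul_pos (Real.log_pos (by nlinarith [sq_pos_of_pos ht0])) (Real.rpow_pos_of_pos ht0 _)
  rw [coulsonConst, setIntegral_pos_iff_support_of_nonneg_ae
    ((ae_restrict_mem measurableSet_Ioi).mono fun t ht => (hpos t ht).le)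
    (integrableOn_log_one_add_sq_mul_rpow hp0 hp2)]
  have : Function.support (fun t : ℝ => Real.log (1 + t ^ 2) * t ^ (-p - 1)) ∩ Ioi 0 = Ioi 0 :=
    inter_eq_right.2 fun t ht => (hpos t ht).ne'
  rw [this]
  simp

theorem log_scaled_eq {p x t : ℝ} (hx : x ≠ 0) (ht : 0 < t) :
    Real.log (1 + (t * x) ^ 2) * t ^ (-p - 1) =
      |x| ^ (p + 1) * (Real.log (1 + (|x| * t) ^ 2) * (|x| * t) ^ (-p - 1)) := by
  have hx' : 0 < |x| := abs_pos.2 hx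
  rw [Real.mul_rpow hx'.le ht.le, mul_pow, mul_pow, sq_abs,
    show -p - 1 = -(p + 1) by ring, Real.rpow_neg hx'.le]
  have : |x| ^ (p + 1) ≠ 0 := (Real.rpow_pos_of_pos hx' _).ne'
  field_simp

theorem integrableOn_log_scaled {p : ℝ} (hp0 : 0 < p) (hp2 : p < 2) (x : ℝ) :
    IntegrableOn (fun t : ℝ => Real.log (1 + (t * x) ^ 2) * t ^ (-p - 1)) (Ioi 0) := by
  by_cases hx : x = 0
  · simp [hx]
  have hx' : 0 < |x| := abs_pos.2 hx
  have h := (integrableOn_Ioi_comp_mul_left_iff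
    (fun t : ℝ => Real.log (1 + t ^ 2) * t ^ (-p - 1)) 0 hx').2
    (by simpa using integrableOn_log_one_add_sq_mul_rpow hp0 hp2)
  exact IntegrableOn.congr_fun (h.const_mul (|x| ^ (p + 1)))
    (fun t ht => (log_scaled_eq hx ht).symm) measurableSet_Ioi

theorem integral_log_scaled {p : ℝ} (hp0 : 0 < p) (x : ℝ) :
    ∫ t in Ioi (0 : ℝ), Real.log (1 + (t * x) ^ 2) * t ^ (-p - 1) =
      coulsonConst p * |x| ^ p := by
  by_cases hx : x = 0
  · simp [hx, Real.zero_rpow hp0.ne']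
  have hx' : 0 < |x| := abs_pos.2 hx
  rw [setIntegral_congr_fun measurableSet_Ioi fun t ht => log_scaled_eq hx ht,
    integral_const_mul, integral_comp_mul_left_Ioi
      (fun t : ℝ => Real.log (1 + t ^ 2) * t ^ (-p - 1)) 0 hx', mul_zero, smul_eq_mul,
    Real.rpow_add_one hx'.ne', ← coulsonConst]
  field_simp

end SchattenEnergy

namespace SchattenEnergy

open MeasureTheory Set

/-! ### Comparing energies through `det (1 + i t A)` -/

open Classical in
theorem norm_shiftDet_sq {V : Type*} [Fintype V] (t : ℝ) (G : SimpleGraph V) :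
    ‖shiftDet (Complex.I * t) G‖ ^ 2 =
      ∏ i, (1 + (t * (adjMatrix_isHermitian G).eigenvalues i) ^ 2) := by
  rw [shiftDet_eq_prod, norm_prod, ← Finset.prod_pow]
  refine Finset.prod_congr rfl fun i _ => ?_
  rw [← Complex.normSq_eq_norm_sq, Complex.normSq_apply]
  simp
  ring

theorem norm_shiftDet_sq_pos {V : Type*} [Fintype V] (t : ℝ) (G : SimpleGraph V) :
    0 < ‖shiftDet (Complex.I * t) G‖ ^ 2 := by
  rw [norm_shiftDet_sq]
  exact Finset.prod_pos fun i _ => by positivity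

open Classical in
theorem log_norm_shiftDet_sq {V : Type*} [Fintype V] (t : ℝ) (G : SimpleGraph V) :
    Real.log (‖shiftDet (Complex.I * t) G‖ ^ 2) =
      ∑ i, Real.log (1 + (t * (adjMatrix_isHermitian G).eigenvalues i) ^ 2) := by
  rw [norm_shiftDet_sq, Real.log_prod]
  intro i _
  positivity

theorem integrableOn_log_norm_shiftDet {V : Type*} [Fintype V] {p : ℝ} (hp0 : 0 < p) (hp2 : p < 2)
    (G : SimpleGraph V) :
    IntegrableOn (fun t : ℝ => Real.log (‖shiftDet (Complex.I * t) G‖ ^ 2) * t ^ (-p - 1))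
      (Ioi 0) := by
  simp_rw [log_norm_shiftDet_sq, Finset.sum_mul]
  exact integrable_finsetSum _ fun i _ => integrableOn_log_scaled hp0 hp2 _

/-- A Coulson-type integral formula for the Schatten energy. -/
theorem integral_log_norm_shiftDet {V : Type*} [Fintype V] {p : ℝ} (hp0 : 0 < p) (hp2 : p < 2)
    (G : SimpleGraph V) :
    ∫ t in Ioi (0 : ℝ), Real.log (‖shiftDet (Complex.I * t) G‖ ^ 2) * t ^ (-p - 1) =
      coulsonConst p * energy p G := by
  simp_rw [log_norm_shiftDet_sq, Finset.sum_mul]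
  rw [integral_finsetSum _ fun i _ => integrableOn_log_scaled hp0 hp2 _, energy, Finset.mul_sum]
  exact Finset.sum_congr rfl fun i _ => integral_log_scaled hp0 _

/-- The two vertex types may differ, as the tree is not on `Fin n`. -/
theorem energy_le_energy {V W : Type*} [Fintype V] [Fintype W] {p : ℝ} (hp0 : 0 < p) (hp2 : p < 2)
    {G : SimpleGraph V} {H : SimpleGraph W}
    (h : ∀ t : ℝ, ‖shiftDet (Complex.I * t) G‖ ≤ ‖shiftDet (Complex.I * t) H‖) :
    energy p G ≤ energy p H := by
  refine le_of_mul_le_mul_left ?_ (coulsonConst_pos hp0 hp2)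
  rw [← integral_log_norm_shiftDet hp0 hp2, ← integral_log_norm_shiftDet hp0 hp2]
  refine setIntegral_mono_on (integrableOn_log_norm_shiftDet hp0 hp2 G)
    (integrableOn_log_norm_shiftDet hp0 hp2 H) measurableSet_Ioi fun t ht => ?_
  refine mul_le_mul_of_nonneg_right ?_ (Real.rpow_nonneg (le_of_lt ht) _)
  refine Real.log_le_log (norm_shiftDet_sq_pos t G) ?_
  gcongr
  exact h t

/-! ### Bounds for forests -/

/-- An acyclic graph with an edge has a leaf. -/
theorem exists_leaf {V : Type*} [Fintype V] {G : SimpleGraph V} (hG : G.IsAcyclic) (hne : G ≠ ⊥) :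
    ∃ v u, ∀ w, G.Adj v w ↔ w = u := by
  classical
  obtain ⟨a, b, hab⟩ := SimpleGraph.ne_bot_iff_exists_adj.1 hne
  set c := G.connectedComponentMk a
  have hb : b ∈ c := SimpleGraph.ConnectedComponent.sound hab.symm.reachable
  have : Nontrivial c := ⟨⟨a, rfl⟩, ⟨b, hb⟩, fun h => hab.ne (congrArg Subtype.val h)⟩
  obtain ⟨v, hv⟩ := (hG.isTree_connectedComponent c).exists_vert_degree_one_of_nontrivial
  obtain ⟨u, hu, huniq⟩ := SimpleGraph.degree_eq_one_iff_existsUnique_adj.1 hv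
  refine ⟨v, u, fun w => ⟨fun hw => ?_, fun hw => hw ▸ hu⟩⟩
  have hwc : w ∈ c := c.mem_supp_of_adj_mem_supp v.2 hw
  exact congrArg Subtype.val (huniq ⟨w, hwc⟩ hw)

theorem ncard_edgeSet_deleteIncidenceSet_leaf {V : Type*} [Finite V] {G : SimpleGraph V} {u v : V}
    (h : ∀ w, G.Adj v w ↔ w = u) :
    (G.deleteIncidenceSet v).edgeSet.ncard + 1 = G.edgeSet.ncard := by
  have hinc : G.incidenceSet v = {s(v, u)} := by
    ext e
    induction e with
    | _ x y =>
      rw [G.mk'_mem_incidenceSet_iff, mem_singleton_iff, Sym2.eq_iff]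
      constructor
      · rintro ⟨hxy, rfl | rfl⟩
        · exact .inl ⟨rfl, (h y).1 hxy⟩
        · exact .inr ⟨(h x).1 hxy.symm, rfl⟩
      · rintro (⟨rfl, rfl⟩ | ⟨rfl, rfl⟩)
        · exact ⟨(h _).2 rfl, .inl rfl⟩
        · exact ⟨((h _).2 rfl).symm, .inr rfl⟩
  rw [SimpleGraph.edgeSet_deleteIncidenceSet, hinc]
  exact ncard_sdiff_singleton_add_one ((h u).2 rfl)

/-- The generating function, evaluated at `s`, of the matchings of the path on `k` vertices. -/
def pathMatching (s : ℝ) : ℕ → ℝ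
  | 0 => 1
  | 1 => 1
  | k + 2 => pathMatching s (k + 1) + s * pathMatching s k

theorem one_le_pathMatching {s : ℝ} (hs : 0 ≤ s) : ∀ k, 1 ≤ pathMatching s k
  | 0 => le_rfl
  | 1 => le_rfl
  | k + 2 => by
    have h1 := one_le_pathMatching hs (k + 1)
    have h2 := one_le_pathMatching hs k
    rw [pathMatching]
    nlinarith

theorem shiftDet_I_leaf {V : Type*} [Fintype V] (t : ℝ) {G : SimpleGraph V} {u v : V}
    (h : ∀ w, G.Adj v w ↔ w = u) :
    shiftDet (Complex.I * t) G = shiftDet (Complex.I * t) (G.deleteIncidenceSet v) +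
      (t ^ 2 : ℝ) *
        shiftDet (Complex.I * t) ((G.deleteIncidenceSet v).deleteIncidenceSet u) := by
  rw [shiftDet_leaf _ h, mul_pow, Complex.I_sq]
  push_cast
  ring

/-- For a forest, `det (1 + i t A)` is a real number, bounded below by the value for a star with
the same number of edges and above by the value for a path with at least as many vertices as the
support of the forest. -/
theorem exists_shiftDet_eq_of_isAcyclic {V : Type*} [Fintype V] (t : ℝ) {G : SimpleGraph V}
    (hG : G.IsAcyclic) :
    ∃ m : ℝ, shiftDet (Complex.I * t) G = m ∧ 1 + G.edgeSet.ncard * t ^ 2 ≤ m ∧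
      ∀ S : Finset V, G.support ⊆ S → m ≤ pathMatching (t ^ 2) S.card := by
  classical
  induction hk : G.edgeSet.ncard using Nat.strong_induction_on generalizing G with
  | _ k ih =>
    subst hk
    by_cases hne : G = ⊥
    · subst hne
      exact ⟨1, by simp [shiftDet_bot], by simp, fun S _ => one_le_pathMatching (sq_nonneg t) _⟩
    obtain ⟨v, u, h⟩ := exists_leaf hG hne
    have huv : u ≠ v := ((h u).2 rfl).ne'
    have hcard := ncard_edgeSet_deleteIncidenceSet_leaf h
    have hle := G.deleteIncidenceSet_le v
    have hle' := (G.deleteIncidenceSet v).deleteIncidenceSet_le u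
    have hcard' : ((G.deleteIncidenceSet v).deleteIncidenceSet u).edgeSet.ncard ≤
        (G.deleteIncidenceSet v).edgeSet.ncard :=
      ncard_le_ncard (SimpleGraph.edgeSet_mono hle')
    obtain ⟨m₁, hm₁, hl₁, hu₁⟩ := ih _ (by omega) (hG.anti hle) rfl
    obtain ⟨m₂, hm₂, hl₂, hu₂⟩ := ih _ (by omega) (hG.anti (hle'.trans hle)) rfl
    refine ⟨m₁ + t ^ 2 * m₂, ?_, ?_, fun S hS => ?_⟩
    · rw [shiftDet_I_leaf t h, hm₁, hm₂]
      push_cast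
      ring
    · rw [← hcard]
      push_cast
      -- The lower bound keeps only the constant term of the second summand: one t² for the deleted
      -- edge.
      have hm₂ : 1 ≤ m₂ := le_trans (by simp; positivity) hl₂
      nlinarith [sq_nonneg t]
    · have hvS : v ∈ S := hS ⟨u, (h u).2 rfl⟩
      have huS : u ∈ S.erase v := Finset.mem_erase.2 ⟨huv, hS ⟨v, ((h u).2 rfl).symm⟩⟩
      -- `S` plays the role of the vertex set: it shrinks by one and by two, matching the path
      -- recursion.
      have h₁ := hu₁ (S.erase v) fun x hx => by
        have := G.support_deleteIncidenceSet_subset v hx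
        exact Finset.mem_erase.2 ⟨this.2, hS this.1⟩
      have h₂ := hu₂ ((S.erase v).erase u) fun x hx => by
        have h' := (G.deleteIncidenceSet v).support_deleteIncidenceSet_subset u hx
        have := G.support_deleteIncidenceSet_subset v h'.1
        exact Finset.mem_erase.2 ⟨h'.2, Finset.mem_erase.2 ⟨this.2, hS this.1⟩⟩
      obtain ⟨j, hj⟩ : ∃ j, ((S.erase v).erase u).card = j := ⟨_, rfl⟩
      have e₁ : (S.erase v).card = j + 1 := by rw [← Finset.card_erase_add_one huS, hj]
      have e₂ : S.card = j + 2 := by rw [← Finset.card_erase_add_one hvS, e₁]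
      rw [hj] at h₂
      rw [e₁] at h₁
      rw [e₂, pathMatching]
      gcongr

/-! ### Stars and paths -/

/-- Deleting the centre leaves no edges, so each peeled leaf contributes exactly t². -/
theorem shiftDet_of_forall_adj_center {V : Type*} [Fintype V] (t : ℝ) (c : V) {G : SimpleGraph V}
    (hG : ∀ x y, G.Adj x y → x = c ∨ y = c) :
    shiftDet (Complex.I * t) G = (1 + G.edgeSet.ncard * t ^ 2 : ℝ) := by
  induction hk : G.edgeSet.ncard generalizing G with
  | zero =>
    have : G = ⊥ := SimpleGraph.edgeSet_eq_empty.1 ((ncard_eq_zero G.edgeSet.toFinite).1 hk)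
    simp [this, shiftDet_bot]
  | succ k ih =>
    have hne : G ≠ ⊥ := by
      rintro rfl
      simp at hk
    obtain ⟨v, hv⟩ : ∃ v, G.Adj v c := by
      obtain ⟨a, b, hab⟩ := SimpleGraph.ne_bot_iff_exists_adj.1 hne
      rcases hG a b hab with rfl | rfl
      exacts [⟨b, hab.symm⟩, ⟨a, hab⟩]
    have h : ∀ w, G.Adj v w ↔ w = c :=
      fun w => ⟨fun hw => (hG v w hw).resolve_left hv.ne, fun hw => hw ▸ hv⟩
    have hcard := ncard_edgeSet_deleteIncidenceSet_leaf h
    have hbot : (G.deleteIncidenceSet v).deleteIncidenceSet c = ⊥ := by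
      ext x y
      simp only [SimpleGraph.deleteIncidenceSet_adj, SimpleGraph.bot_adj, iff_false]
      rintro ⟨⟨hxy, -⟩, hx, hy⟩
      exact (hG x y hxy).elim hx hy
    rw [shiftDet_I_leaf t h, hbot, shiftDet_bot,
      ih (fun x y hxy => hG x y (G.deleteIncidenceSet_le v hxy)) (by omega)]
    push_cast
    ring

/-- Truncating the path inside `Fin n` keeps the type fixed while its last vertices are peeled off.
-/
theorem shiftDet_initial_path {n : ℕ} (t : ℝ) (k : ℕ) (hk : k ≤ n) {G : SimpleGraph (Fin n)}
    (hG : ∀ x y, G.Adj x y ↔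
      (SimpleGraph.pathGraph n).Adj x y ∧ x.val < k ∧ y.val < k) :
    shiftDet (Complex.I * t) G = pathMatching (t ^ 2) k := by
  simp_rw [SimpleGraph.pathGraph_adj] at hG
  induction k using Nat.strong_induction_on generalizing G with
  | _ k ih =>
    match k with
    | 0 | 1 =>
      have : G = ⊥ := by
        ext x y
        rw [hG, SimpleGraph.bot_adj, iff_false]
        omega
      rw [this, shiftDet_bot, pathMatching, Complex.ofReal_one]
    | k + 2 =>
      have h : ∀ w, G.Adj (⟨k + 1, by omega⟩ : Fin n) w ↔ w = ⟨k, by omega⟩ := fun w => by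
        rw [hG, Fin.ext_iff]
        simp only
        omega
      rw [shiftDet_I_leaf t h, ih (k + 1) (by omega) (by omega), ih k (by omega) (by omega),
        pathMatching]
      · push_cast
        ring
      all_goals
        intro x y
        simp only [SimpleGraph.deleteIncidenceSet_adj, hG, ne_eq, Fin.ext_iff]
        omega

theorem shiftDet_pathGraph (t : ℝ) (n : ℕ) :
    shiftDet (Complex.I * t) (SimpleGraph.pathGraph n) = pathMatching (t ^ 2) n :=
  shiftDet_initial_path t n le_rfl fun x y => by simp

theorem ncard_edgeSet_of_isTree {V : Type*} [Fintype V] {T : SimpleGraph V} (hT : T.IsTree) :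
    T.edgeSet.ncard + 1 = Fintype.card V := by
  classical
  rw [← hT.card_edgeFinset, ← SimpleGraph.coe_edgeFinset, ncard_coe_finset]

end SchattenEnergy

open SchattenEnergy in
theorem theorem2 {V : Type*} [Fintype V] (T : SimpleGraph V) (hT : T.IsTree)
    (n : ℕ) [NeZero n] (hn : Fintype.card V = n) (p : ℝ) (hp0 : 0 < p) (hp2 : p < 2) :
    SchattenEnergy.energy p (SimpleGraph.starGraph (0 : Fin n)) ≤ SchattenEnergy.energy p T ∧
      SchattenEnergy.energy p T ≤ SchattenEnergy.energy p (SimpleGraph.pathGraph n) := by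
  have hcard : (SimpleGraph.starGraph (0 : Fin n)).edgeSet.ncard = T.edgeSet.ncard := by
    have h₁ := ncard_edgeSet_of_isTree (SimpleGraph.isTree_starGraph (0 : Fin n))
    have h₂ := ncard_edgeSet_of_isTree hT
    rw [Fintype.card_fin] at h₁
    omega
  refine ⟨energy_le_energy hp0 hp2 fun t => ?_, energy_le_energy hp0 hp2 fun t => ?_⟩
  all_goals obtain ⟨m, hm, hl, hu⟩ := exists_shiftDet_eq_of_isAcyclic t hT.isAcyclic
  all_goals have hpos : 0 < 1 + T.edgeSet.ncard * t ^ 2 := by positivity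
  · rw [hm, shiftDet_of_forall_adj_center t 0 fun x y h => (SimpleGraph.starGraph_adj.1 h).2,
      hcard, Complex.norm_of_nonneg hpos.le, Complex.norm_of_nonneg (hpos.le.trans hl)]
    exact hl
  · have := hu Finset.univ (by simp)
    rw [Finset.card_univ, hn] at this
    rw [hm, shiftDet_pathGraph, Complex.norm_of_nonneg (hpos.le.trans hl),
      Complex.norm_of_nonneg (hpos.le.trans (hl.trans this))]
    exact this
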